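/- Let $n\ge 2$, $k\ge 1$, $D\ge 1$ be integers, $0<q<p<1$ and $0<r<1$. Let $z_1,\dots,z_n$ be i.i.d. uniform on $\{1,\dots,k\}$, let $M\in[0,1]^{n\times n}$ be the matrix with $M_{ii}=0$ and $M_{ij}=p\,\mathbf 1(z_i=z_j)+q\,\mathbf 1(z_i\neq z_j)$ for $i\neq j$, and, given $M$, let $A\in\{0,1\}^{n\times n}$ be symmetric with zero diagonal and independent entries $A_{ij}\sim\mathrm{Bernoulli}(M_{ij})$, $i<j$. Write $\mathbb P_{\mathrm{SBM}(p,q)}$ for the joint law of $(A,M)$. Let $Z_M$ be the membership matrix, $(Z_M)_{ii}=0$ and $(Z_M)_{ij}=\mathbf 1(z_i=z_j)=(M_{ij}-q)/(p-q)$ for $i\ne j$, and let $\ell(\widehat Z,Z)=\binom n2^{-1}\sum_{1\le i<j\le n}(\widehat Z_{ij}-Z_{ij})^2$. Let $\mathbb R[A]^{n\times n}_{\le D}$ be the set of estimators $\widehat Z$ each of whose entries is a real polynomial of degree at most $D$ in the entries of $A$ (the coefficients may depend on $n,k,p,q$). If $$\frac{(p-q)^2}{q(1-p)}\le\frac{r}{(D(D+1))^2}\left(\frac{k^2}{n}\wedge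 1\right),$$ then $$\inf_{\widehat Z\in\mathbb R[A]^{n\times n}_{\le D}}\mathbb E_{A,M\sim\mathbb P_{\mathrm{SBM}(p,q)}}\,\ell(\widehat Z,Z_M)\ \ge\ \frac1k-\left(\frac1{k^2}+\frac{r(2-r)}{(1-r)^2n}\right).$$ In particular, the same lower bound holds when $k\le\sqrt n$ and $$\frac{n(p-q)^2}{k^2q(1-p)}\le\frac{r}{(D(D+1))^2}.$$ -/

import Mathlib

/-- Unordered pairs of distinct vertices of `[n]`, represented as pairs `i < j`. -/
abbrev VertexPair (n : ℕ) : Type := {e : Fin n × Fin n // e.1 < e.2}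

/-- The connectivity matrix `M` of the `k`-class stochastic block model with labels `z`:
zero diagonal, `M i j = p` if `z i = z j` and `M i j = q` if `z i ≠ z j` (for `i ≠ j`). -/
def connMatrix {n k : ℕ} (p q : ℝ) (z : Fin n → Fin k) : Matrix (Fin n) (Fin n) ℝ :=
  Matrix.of fun i j => if i = j then 0 else if z i = z j then p else q

/-- The membership matrix `Z_M`, as a function of `M`: zero diagonal and
`(Z_M) i j = (M i j - q) / (p - q)` for `i ≠ j`. -/
noncomputable def membershipMatrix {n : ℕ} (p q : ℝ) (M : Matrix (Fin n) (Fin n) ℝ) :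
    Matrix (Fin n) (Fin n) ℝ :=
  Matrix.of fun i j => if i = j then 0 else (M i j - q) / (p - q)

/-- On connectivity matrices, `Z_M` is the co-membership indicator of the labels. -/
theorem membershipMatrix_connMatrix {n k : ℕ} {p q : ℝ} (hpq : q < p) (z : Fin n → Fin k)
    (i j : Fin n) :
    membershipMatrix p q (connMatrix p q z) i j
      = if i = j then 0 else if z i = z j then 1 else 0 := by
  have h : p - q ≠ 0 := sub_ne_zero.mpr hpq.ne'
  by_cases hij : i = j <;> by_cases hz : z i = z j <;>
    simp [membershipMatrix, connMatrix, hij, hz, h]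

/-- The (symmetric, zero-diagonal) adjacency matrix of the graph on `[n]` whose edges are the
pairs `i < j` with `y (i, j) = true`. -/
def adjOfEdges {n : ℕ} (y : VertexPair n → Bool) : Matrix (Fin n) (Fin n) ℝ :=
  Matrix.of fun i j =>
    if h : i < j then (if y ⟨(i, j), h⟩ then 1 else 0)
    else if h : j < i then (if y ⟨(j, i), h⟩ then 1 else 0)
    else 0

/-- Conditional probability of the graph `y` given `M`: the edges `i < j` are present
independently with probability `M i j`. -/
def graphProb {n : ℕ} (M : Matrix (Fin n) (Fin n) ℝ) (y : VertexPair n → Bool) : ℝ :=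
  ∏ e : VertexPair n, if y e then M e.1.1 e.1.2 else 1 - M e.1.1 e.1.2

/-- The expectation of `F A M` when the labels are i.i.d. uniform on the `k` classes, `M` is the
connectivity matrix of the labels, and, given `M`, `A` is the adjacency matrix of the random graph
with independent edges of probabilities `M i j`. -/
noncomputable def sbmExpectation (n k : ℕ) (p q : ℝ)
    (F : Matrix (Fin n) (Fin n) ℝ → Matrix (Fin n) (Fin n) ℝ → ℝ) : ℝ :=
  ∑ z : Fin n → Fin k, (1 / (k : ℝ)) ^ n *
    ∑ y : VertexPair n → Bool,
      graphProb (connMatrix p q z) y * F (adjOfEdges y) (connMatrix p q z)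

/-- The total mass is one. -/
theorem sbmExpectation_one (n k : ℕ) (hk : 1 ≤ k) (p q : ℝ) :
    sbmExpectation n k p q (fun _ _ => 1) = 1 := by
  have h : ∀ M : Matrix (Fin n) (Fin n) ℝ, ∑ y, graphProb M y = 1 := by
    intro M
    have := Fintype.prod_sum (fun (e : VertexPair n) (b : Bool) =>
      if b = true then M e.1.1 e.1.2 else 1 - M e.1.1 e.1.2)
    simp only [graphProb]
    rw [← this]
    simp
  have hk' : (k : ℝ) ≠ 0 := by positivity
  simp [sbmExpectation, h, hk']

/-- The loss `ℓ(Ẑ, Z)`: the average of `(Ẑ i j - Z i j)²` over the pairs `i < j`. -/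
noncomputable def pairLoss {n : ℕ} (Zhat Z : Matrix (Fin n) (Fin n) ℝ) : ℝ :=
  1 / (n.choose 2 : ℝ) * ∑ e : VertexPair n, (Zhat e.1.1 e.1.2 - Z e.1.1 e.1.2) ^ 2

/-- A matrix-valued polynomial estimator: each entry is a real polynomial in the entries
of the adjacency matrix. -/
abbrev PolyEstimator (n : ℕ) : Type :=
  Matrix (Fin n) (Fin n) (MvPolynomial (Fin n × Fin n) ℝ)

/-- Every entry of the estimator is a polynomial of (total) degree at most `D`. -/
def PolyEstimator.DegreeLE {n : ℕ} (P : PolyEstimator n) (D : ℕ) : Prop :=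
  ∀ i j, (P i j).totalDegree ≤ D

/-- The value of the estimator at the observed adjacency matrix `A`. -/
noncomputable def PolyEstimator.evalAt {n : ℕ} (P : PolyEstimator n)
    (A : Matrix (Fin n) (Fin n) ℝ) : Matrix (Fin n) (Fin n) ℝ :=
  Matrix.of fun i j => MvPolynomial.eval (fun e => A e.1 e.2) (P i j)

/-- The risk `E ℓ(Ẑ(A), Z_M)` of a polynomial estimator of the membership matrix. -/
noncomputable def clusteringRisk {n : ℕ} (k : ℕ) (p q : ℝ) (P : PolyEstimator n) : ℝ :=
  sbmExpectation n k p q fun A M => pairLoss (P.evalAt A) (membershipMatrix p q M)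

/-! The risk averages over pairs, so fix a pair `e₀` with membership indicator `x`. On 0/1 entries,
an estimator entry of degree at most `D` is `f = ∑ a α ∏_{e ∈ α} (A_e - q)` over edge sets with `|α|
≤ D`. Given the labels, re-expand `f` around the true edge means. The new products are orthogonal
with variances at least `(q(1-p))^|β|`, and their coefficients `h_β(z)` depend on the labels. Jensen
gives `E f² ≥ ∑ (q(1-p))^|β| H_β²` with `H_β = E h_β`.

The correlation `E[x f]` involves only `h_∅`, but it is also linear in the averages: `E[x f] = ∑ κ_β
(p-q)^|β| H_β`, where `κ` solves the triangular system `P(e₀ ∪ α mono) = ∑_{β ⊆ α} κ_β P(α \ β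
mono)`. Completing the square in each `H_β` bounds the risk below by `1/k - ∑ κ_β² s^|β|`, with `s =
(p-q)²/(q(1-p))` (`pair_risk_ge`).

It remains to bound `κ`. Like a cumulant, `κ_β` vanishes as soon as part of `β` splits off
independently (`cumulant_eq_zero`). So for nonempty `β` with `κ_β ≠ 0`, the set `β` is connected to
`e₀`, touches both its ends, and has degree at least two at every other vertex. With `d = |β|` and
`m` vertices outside `e₀`, this forces `m < d`. Positive correlation gives `|κ_β| ≤ (d+1)^d
k^{-(m+1)}`, and at most `n^m (d²)^d` sets have this shape. The hypothesis on `s` makes each `(d,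
m)` contribute at most `r^d / n`. The empty set gives `1/k²`, and the rest sums to at most `∑ d r^d
/ n ≤ r / ((1-r)² n)`. -/

/-! ### Uniform labels and monochromatic sets of pairs -/

/-- The average of `f` over all labelings of `[n]` by `k` classes. -/
noncomputable def labelMean {n k : ℕ} (f : (Fin n → Fin k) → ℝ) : ℝ :=
  (1 / (k : ℝ)) ^ n * ∑ z, f z

/-- The indicator that all pairs in `S` are monochromatic under `z`. -/
def monoInd {n k : ℕ} (S : Finset (VertexPair n)) (z : Fin n → Fin k) : ℝ :=
  ∏ e ∈ S, if z e.1.1 = z e.1.2 then 1 else 0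

/-- The probability that all pairs in `S` are monochromatic under uniform labels. -/
noncomputable def monoProb {n : ℕ} (k : ℕ) (S : Finset (VertexPair n)) : ℝ :=
  labelMean (k := k) (monoInd S)

theorem monoInd_eq {n k : ℕ} (S : Finset (VertexPair n)) (z : Fin n → Fin k) :
    monoInd S z = if ∀ e ∈ S, z e.1.1 = z e.1.2 then 1 else 0 := by
  simp [monoInd, Finset.prod_ite_zero]

theorem monoInd_union {n k : ℕ} {S T : Finset (VertexPair n)} (h : Disjoint S T)
    (z : Fin n → Fin k) : monoInd (S ∪ T) z = monoInd S z * monoInd T z :=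
  Finset.prod_union h

theorem labelMean_const {n k : ℕ} (hk : 1 ≤ k) (c : ℝ) :
    labelMean (n := n) (k := k) (fun _ => c) = c := by
  have : (k : ℝ) ≠ 0 := by positivity
  simp [labelMean, this]

theorem labelMean_mono {n k : ℕ} {f g : (Fin n → Fin k) → ℝ} (h : ∀ z, f z ≤ g z) :
    labelMean f ≤ labelMean g :=
  mul_le_mul_of_nonneg_left (Finset.sum_le_sum fun z _ => h z) (by positivity)

theorem labelMean_mul_left {n k : ℕ} (c : ℝ) (f : (Fin n → Fin k) → ℝ) :
    labelMean (fun z => c * f z) = c * labelMean f := by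
  simp only [labelMean, ← Finset.mul_sum]; ring

theorem labelMean_sum {n k : ℕ} {ι : Type*} (s : Finset ι) (f : ι → (Fin n → Fin k) → ℝ) :
    labelMean (fun z => ∑ i ∈ s, f i z) = ∑ i ∈ s, labelMean (f i) := by
  simp only [labelMean, ← Finset.mul_sum]
  rw [Finset.sum_comm]

theorem sq_labelMean_le {n k : ℕ} (hk : 1 ≤ k) (f : (Fin n → Fin k) → ℝ) :
    labelMean f ^ 2 ≤ labelMean fun z => f z ^ 2 := by
  have hk' : (0 : ℝ) < k := by exact_mod_cast hk
  have h := sq_sum_le_card_mul_sum_sq (s := Finset.univ) (f := f)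
  have hc : ((Finset.univ : Finset (Fin n → Fin k)).card : ℝ) = (k : ℝ) ^ n := by simp
  rw [hc] at h
  have h1 : (1 / (k : ℝ)) ^ n * (k : ℝ) ^ n = 1 := by
    rw [← mul_pow, one_div_mul_cancel hk'.ne', one_pow]
  calc labelMean f ^ 2 = ((1 / (k : ℝ)) ^ n) ^ 2 * (∑ z, f z) ^ 2 := by
        rw [labelMean, mul_pow]
    _ ≤ ((1 / (k : ℝ)) ^ n) ^ 2 * ((k : ℝ) ^ n * ∑ z, f z ^ 2) := by gcongr
    _ = (1 / (k : ℝ)) ^ n * ((1 / (k : ℝ)) ^ n * (k : ℝ) ^ n) * ∑ z, f z ^ 2 := by ring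
    _ = _ := by rw [h1, mul_one, labelMean]

/-- Functions of disjoint sets of labels are independent. -/
theorem labelMean_mul_of_dependsOn {n k : ℕ} (hk : 1 ≤ k) (T : Finset (Fin n))
    {f g : (Fin n → Fin k) → ℝ} (hf : DependsOn f (T : Set (Fin n)))
    (hg : DependsOn g (T : Set (Fin n))ᶜ) :
    labelMean (fun z => f z * g z) = labelMean f * labelMean g := by
  have hk' : (k : ℝ) ≠ 0 := by positivity
  -- Exchanging the coordinates outside `T` or inside `T` between two independent labelings
  -- preserves the uniform law; `σ` mixes them so that `f` and `g` can be read off one labeling.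
  let σ : (Fin n → Fin k) × (Fin n → Fin k) → (Fin n → Fin k) × (Fin n → Fin k) :=
    fun x => (T.piecewise x.1 x.2, T.piecewise x.2 x.1)
  have hσ : Function.Involutive σ := by
    rintro ⟨x, y⟩
    ext i <;> by_cases hi : i ∈ T <;> simp [σ, hi]
  have key : (∑ z, f z) * ∑ z, g z = (k : ℝ) ^ n * ∑ z, f z * g z := by
    have h1 : ∑ x : (Fin n → Fin k) × (Fin n → Fin k), f x.1 * g x.2
        = ∑ x : (Fin n → Fin k) × (Fin n → Fin k), f x.1 * g x.1 := by
      refine Fintype.sum_equiv hσ.toPerm _ _ ?_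
      rintro ⟨x, y⟩
      congr 1
      · exact hf fun i hi => by simp_all [σ]
      · exact hg fun i hi => by simp_all [σ]
    rw [Finset.sum_mul_sum, ← Fintype.sum_prod_type', h1,
      Fintype.sum_prod_type' (f := fun x (_ : Fin n → Fin k) => f x * g x)]
    simp [Finset.mul_sum]
  simp only [labelMean]
  have h1 : (1 / (k : ℝ)) ^ n * (k : ℝ) ^ n = 1 := by
    rw [← mul_pow, one_div_mul_cancel hk', one_pow]
  calc _ = (1 / (k : ℝ)) ^ n * ((1 / (k : ℝ)) ^ n * (k : ℝ) ^ n) * ∑ z, f z * g z := by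
        rw [h1, mul_one]
    _ = (1 / (k : ℝ)) ^ n * (1 / (k : ℝ)) ^ n * ((k : ℝ) ^ n * ∑ z, f z * g z) := by ring
    _ = _ := by rw [← key]; ring

/-- Averaging over one label first. -/
theorem labelMean_update {n k : ℕ} (w : Fin n) (f : (Fin n → Fin k) → ℝ) :
    (k : ℝ) * labelMean f = labelMean fun z => ∑ c, f (Function.update z w c) := by
  -- Swapping the label at `w` with an independent extra label is a measure-preserving involution.
  let σ : (Fin n → Fin k) × Fin k → (Fin n → Fin k) × Fin k :=
    fun x => (Function.update x.1 w x.2, x.1 w)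
  have hσ : Function.Involutive σ := by
    rintro ⟨x, y⟩
    simp [σ]
  have h1 : ∑ x : (Fin n → Fin k) × Fin k, f (Function.update x.1 w x.2)
        = ∑ x : (Fin n → Fin k) × Fin k, f x.1 :=
    Fintype.sum_equiv hσ.toPerm _ _ fun x => rfl
  rw [Fintype.sum_prod_type, Fintype.sum_prod_type] at h1
  simp only [labelMean, h1]
  simp [Finset.mul_sum]
  refine Finset.sum_congr rfl fun z _ => by ring

theorem monoProb_nonneg {n : ℕ} (k : ℕ) (S : Finset (VertexPair n)) : 0 ≤ monoProb k S := by
  refine mul_nonneg (by positivity) (Finset.sum_nonneg fun z _ => ?_)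
  rw [monoInd_eq]; split_ifs <;> norm_num

theorem monoProb_empty {n k : ℕ} (hk : 1 ≤ k) : monoProb k (∅ : Finset (VertexPair n)) = 1 := by
  have : (monoInd ∅ : (Fin n → Fin k) → ℝ) = fun _ => 1 := by funext z; simp [monoInd]
  rw [monoProb, this, labelMean_const hk]

/-- Adding a pendant pair divides the monochromaticity probability by `k`. -/
theorem monoProb_insert_pendant {n k : ℕ} (hk : 1 ≤ k) {S : Finset (VertexPair n)}
    {e : VertexPair n} {w : Fin n} (hw : e.1.1 = w ∨ e.1.2 = w)
    (hS : ∀ e' ∈ S, e'.1.1 ≠ w ∧ e'.1.2 ≠ w) :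
    monoProb k (insert e S) = monoProb k S * (1 / (k : ℝ)) := by
  have hk' : (k : ℝ) ≠ 0 := by positivity
  have he : e ∉ S := fun h => by have := hS e h; tauto
  have hne : e.1.1 ≠ e.1.2 := e.2.ne
  have key : (k : ℝ) * monoProb k (insert e S) = monoProb k S := by
    rw [monoProb, labelMean_update w, monoProb]
    congr 1
    funext z
    have h1 : ∀ c, monoInd (insert e S) (Function.update z w c)
        = (if Function.update z w c e.1.1 = Function.update z w c e.1.2 then 1 else 0)
          * monoInd S z := by
      intro c
      rw [monoInd, Finset.prod_insert he, monoInd]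
      congr 1
      refine Finset.prod_congr rfl fun e' he' => ?_
      rw [Function.update_of_ne (hS e' he').1, Function.update_of_ne (hS e' he').2]
    simp only [h1, ← Finset.sum_mul]
    rcases hw with rfl | rfl
    · simp [Function.update_of_ne hne.symm]
    · simp [Function.update_of_ne hne]
  rw [← key]; field_simp

theorem monoProb_singleton {n k : ℕ} (hk : 1 ≤ k) (e : VertexPair n) :
    monoProb k {e} = 1 / (k : ℝ) := by
  have := monoProb_insert_pendant hk (S := ∅) (e := e) (Or.inl rfl) (by simp)
  simpa [monoProb_empty hk] using this

/-- Monochromaticity events of vertex-disjoint sets of pairs are independent. -/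
theorem monoProb_union_of_separated {n k : ℕ} (hk : 1 ≤ k) (W : Finset (Fin n))
    {S T : Finset (VertexPair n)} (hS : ∀ e ∈ S, e.1.1 ∈ W ∧ e.1.2 ∈ W)
    (hT : ∀ e ∈ T, e.1.1 ∉ W ∧ e.1.2 ∉ W) :
    monoProb k (S ∪ T) = monoProb k S * monoProb k T := by
  have hd : Disjoint S T := Finset.disjoint_left.2 fun e h1 h2 => (hT e h2).1 (hS e h1).1
  simp only [monoProb]
  rw [← labelMean_mul_of_dependsOn hk W (f := monoInd S) (g := monoInd T)]
  · congr 1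
    funext z
    exact monoInd_union hd z
  · intro x y h
    refine Finset.prod_congr rfl fun e he => ?_
    rw [h _ (hS e he).1, h _ (hS e he).2]
  · intro x y h
    refine Finset.prod_congr rfl fun e he => ?_
    rw [h _ (hT e he).1, h _ (hT e he).2]

/-! ### Positive correlation and decay of monochromaticity probabilities -/

/-- Labelings for which all pairs of `S` are monochromatic, as a subgroup. -/
def monoSubgroup {n : ℕ} (k : ℕ) [NeZero k] (S : Finset (VertexPair n)) :
    AddSubgroup (Fin n → Fin k) where
  carrier := {z | ∀ e ∈ S, z e.1.1 = z e.1.2}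
  zero_mem' := fun _ _ => rfl
  add_mem' := fun hx hy e he => by simp [hx e he, hy e he]
  neg_mem' := fun hx e he => by simp [hx e he]

/-- Lagrange's theorem in the group of labelings modulo `k`. Positive correlation then becomes
submultiplicativity of the index under intersection. -/
theorem monoProb_eq_index {n k : ℕ} [NeZero k] (S : Finset (VertexPair n)) :
    monoProb k S = 1 / ((monoSubgroup k S).index : ℝ) := by
  classical
  have hk : (k : ℝ) ≠ 0 := by simp [NeZero.ne k]
  have h1 : ∑ z : Fin n → Fin k, monoInd S z = Nat.card (monoSubgroup k S) := by
    simp only [monoInd_eq, Finset.sum_boole]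
    rw [← Fintype.card_subtype, ← Nat.card_eq_fintype_card]
    rfl
  have h2 : (Nat.card (monoSubgroup k S) : ℝ) * (monoSubgroup k S).index = (k : ℝ) ^ n := by
    have := (monoSubgroup k S).card_mul_index
    rw [Nat.card_fun, Nat.card_fin, Nat.card_fin] at this
    rw [← Nat.cast_mul, this, Nat.cast_pow]
  have h3 : ((monoSubgroup k S).index : ℝ) ≠ 0 := by
    exact_mod_cast AddSubgroup.index_ne_zero_of_finite
  rw [monoProb, labelMean, h1, eq_div_iff h3, mul_assoc, h2, ← mul_pow,
    one_div_mul_cancel hk, one_pow]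

/-- Monochromaticity events are positively correlated. -/
theorem monoProb_mul_le {n k : ℕ} (hk : 1 ≤ k) (S T : Finset (VertexPair n)) :
    monoProb k S * monoProb k T ≤ monoProb k (S ∪ T) := by
  have : NeZero k := ⟨by omega⟩
  have hinf : monoSubgroup k (S ∪ T) = monoSubgroup k S ⊓ monoSubgroup k T := by
    ext z
    simp only [monoSubgroup, AddSubgroup.mem_inf, AddSubgroup.mem_mk]
    change (∀ e ∈ S ∪ T, _) ↔ (∀ e ∈ S, _) ∧ (∀ e ∈ T, _)
    simp only [Finset.mem_union, or_imp, forall_and]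
  have h0 : ∀ S : Finset (VertexPair n), 0 < ((monoSubgroup k S).index : ℝ) := fun S => by
    exact_mod_cast Nat.pos_of_ne_zero AddSubgroup.index_ne_zero_of_finite
  simp only [monoProb_eq_index]
  rw [div_mul_div_comm, one_mul]
  refine one_div_le_one_div_of_le (h0 _) ?_
  rw [hinf]
  exact_mod_cast AddSubgroup.index_inf_le

/-- If monochromaticity of `S` forces the labels to be constant on `insert i U`, then it has
probability at most `k⁻¹ ^ |U|`. -/
theorem monoProb_le_of_forces_const {n k : ℕ} (hk : 1 ≤ k) {S : Finset (VertexPair n)}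
    {i : Fin n} {U : Finset (Fin n)} (hi : i ∉ U)
    (h : ∀ z : Fin n → Fin k, (∀ e ∈ S, z e.1.1 = z e.1.2) → ∀ j ∈ U, z j = z i) :
    monoProb k S ≤ (1 / (k : ℝ)) ^ U.card := by
  classical
  have hk' : (k : ℝ) ≠ 0 := by positivity
  have h1 : (∑ z : Fin n → Fin k, monoInd S z) ≤ (k : ℝ) ^ (n - U.card) := by
    simp only [monoInd_eq, Finset.sum_boole]
    have : (Finset.univ.filter fun z : Fin n → Fin k => ∀ e ∈ S, z e.1.1 = z e.1.2).card
        ≤ Fintype.card ({j // j ∈ Uᶜ} → Fin k) := by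
      -- A monochromatic labeling is determined by its restriction to the complement of `U`, which
      -- still contains `i`.
      refine Finset.card_le_card_of_injOn (t := Finset.univ) (fun z j => z j.1)
        (fun _ _ => Finset.mem_coe.2 (Finset.mem_univ _)) ?_
      intro x hx y hy hxy
      simp only [Finset.coe_filter, Finset.mem_univ, true_and, Set.mem_ofPred_eq] at hx hy
      have hc : ∀ j, j ∉ U → x j = y j := fun j hj =>
        congrFun hxy ⟨j, Finset.mem_compl.2 hj⟩
      funext j
      by_cases hj : j ∈ U
      · rw [h x hx j hj, h y hy j hj, hc i hi]
      · exact hc j hj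
    rw [Fintype.card_fun, Fintype.card_coe, Finset.card_compl, Fintype.card_fin,
      Fintype.card_fin] at this
    exact_mod_cast this
  have hU : U.card ≤ n := by simpa using U.card_le_univ
  calc monoProb k S ≤ (1 / (k : ℝ)) ^ n * (k : ℝ) ^ (n - U.card) := by
        rw [monoProb, labelMean]; gcongr
    _ = (1 / (k : ℝ)) ^ U.card := by
        rw [← pow_mul_pow_sub (1 / (k : ℝ)) hU, mul_assoc, ← mul_pow,
          one_div_mul_cancel hk', one_pow, mul_one]

/-! ### Abstract cumulants -/

/-- The solution `κ` of `c α = ∑ β ⊆ α, κ β * b (α \ β)`. -/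
noncomputable def cumulant {E : Type*} [DecidableEq E] (b c : Finset E → ℝ) (α : Finset E) : ℝ :=
  c α - ∑ β ∈ α.ssubsets.attach, cumulant b c β.1 * b (α \ β.1)
termination_by α.card
decreasing_by exact Finset.card_lt_card (Finset.mem_ssubsets.1 β.2)

theorem cumulant_eq {E : Type*} [DecidableEq E] (b c : Finset E → ℝ) (α : Finset E) :
    cumulant b c α = c α - ∑ β ∈ α.ssubsets, cumulant b c β * b (α \ β) := by
  rw [cumulant, Finset.sum_attach α.ssubsets (fun β => cumulant b c β * b (α \ β))]

theorem sum_cumulant {E : Type*} [DecidableEq E] {b : Finset E → ℝ} (c : Finset E → ℝ)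
    (hb : b ∅ = 1) (α : Finset E) :
    ∑ β ∈ α.powerset, cumulant b c β * b (α \ β) = c α := by
  have : α.powerset = insert α α.ssubsets := by
    rw [Finset.ssubsets, Finset.insert_erase (Finset.mem_powerset_self α)]
  rw [this, Finset.sum_insert (by simp), cumulant_eq]
  simp [hb]

/-- Cumulants vanish on sets that split off an independent nonempty part. -/
theorem cumulant_eq_zero {E : Type*} [DecidableEq E] {b c : Finset E → ℝ} (hb : b ∅ = 1)
    {α α₂ : Finset E} (h2 : (α ∩ α₂).Nonempty)
    (hbm : ∀ γ ⊆ α, b γ = b (γ \ α₂) * b (γ ∩ α₂))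
    (hcm : ∀ γ ⊆ α, c γ = c (γ \ α₂) * b (γ ∩ α₂)) : cumulant b c α = 0 := by
  -- Strong induction needs the claim for every subset of `α` that meets `α₂`.
  suffices H : ∀ m, ∀ γ ⊆ α, γ.card = m → (γ ∩ α₂).Nonempty → cumulant b c γ = 0 from
    H _ α subset_rfl rfl h2
  intro m
  induction m using Nat.strong_induction_on with
  | _ m ih =>
    intro γ hγ hm hne
    have hnot : γ ∉ (γ \ α₂).powerset := by
      intro h
      obtain ⟨x, hx⟩ := hne
      have := Finset.mem_powerset.1 h (Finset.mem_inter.1 hx).1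
      exact (Finset.mem_sdiff.1 this).2 (Finset.mem_inter.1 hx).2
    -- By induction, only `γ` itself and the sets avoiding `α₂` survive in the defining relation. By
    -- factorization the latter already sum to `c γ`, which leaves nothing for `γ`.
    have hsum : ∑ β ∈ insert γ (γ \ α₂).powerset, cumulant b c β * b (γ \ β) = c γ := by
      rw [← sum_cumulant c hb γ]
      refine Finset.sum_subset ?_ ?_
      · intro β hβ
        rcases Finset.mem_insert.1 hβ with rfl | h
        · exact Finset.mem_powerset_self _
        · exact Finset.mem_powerset.2 ((Finset.mem_powerset.1 h).trans Finset.sdiff_subset)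
      · intro β hβ hβ'
        have hβγ := Finset.mem_powerset.1 hβ
        have hβne : β ≠ γ := fun h => hβ' (h ▸ Finset.mem_insert_self _ _)
        have hlt : β.card < m := hm ▸ Finset.card_lt_card (hβγ.ssubset_of_ne hβne)
        rw [ih _ hlt β (hβγ.trans hγ) rfl, zero_mul]
        by_contra hemp
        refine hβ' (Finset.mem_insert_of_mem (Finset.mem_powerset.2 fun x hx =>
          Finset.mem_sdiff.2 ⟨hβγ hx, fun hx2 => hemp ⟨x, Finset.mem_inter.2 ⟨hx, hx2⟩⟩⟩))
    rw [Finset.sum_insert hnot, Finset.sdiff_self, hb, mul_one] at hsum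
    have hrest : ∑ β ∈ (γ \ α₂).powerset, cumulant b c β * b (γ \ β) = c γ := by
      rw [hcm γ hγ, ← sum_cumulant c hb (γ \ α₂), Finset.sum_mul]
      refine Finset.sum_congr rfl fun β hβ => ?_
      have hβ' := Finset.mem_powerset.1 hβ
      rw [hbm (γ \ β) (Finset.sdiff_subset.trans hγ), mul_assoc]
      have e1 : (γ \ β) \ α₂ = (γ \ α₂) \ β := by
        ext x; simp only [Finset.mem_sdiff]; tauto
      have e2 : (γ \ β) ∩ α₂ = γ ∩ α₂ := by
        ext x
        have := @hβ' x
        simp only [Finset.mem_sdiff, Finset.mem_inter] at this ⊢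
        tauto
      rw [e1, e2]
    linarith

/-- Induction along the recursion: a proper subset has `|β| + 1 ≤ |α|`, so its term is at most
`|α|^|β| c α`, and the binomial identity `∑_{β ⊆ α} |α|^|β| = (|α|+1)^|α|` closes the bound. -/
theorem abs_cumulant_le {E : Type*} [DecidableEq E] {b c : Finset E → ℝ}
    (hb0 : ∀ α, 0 ≤ b α) (hc0 : ∀ α, 0 ≤ c α)
    (hsub : ∀ α β, β ⊆ α → c β * b (α \ β) ≤ c α) (α : Finset E) :
    |cumulant b c α| ≤ ((α.card : ℝ) + 1) ^ α.card * c α := by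
  induction hm : α.card using Nat.strong_induction_on generalizing α with
  | _ m ih =>
    subst hm
    have hterm : ∀ β ∈ α.ssubsets, |cumulant b c β * b (α \ β)|
        ≤ (α.card : ℝ) ^ β.card * c α := by
      intro β hβ
      have hss := Finset.mem_ssubsets.1 hβ
      have hlt := Finset.card_lt_card hss
      rw [abs_mul, abs_of_nonneg (hb0 _)]
      have hle : (β.card : ℝ) + 1 ≤ α.card := by exact_mod_cast hlt
      calc |cumulant b c β| * b (α \ β)
          ≤ (((β.card : ℝ) + 1) ^ β.card * c β) * b (α \ β) :=
            mul_le_mul_of_nonneg_right (ih _ hlt β rfl) (hb0 _)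
        _ = ((β.card : ℝ) + 1) ^ β.card * (c β * b (α \ β)) := by ring
        _ ≤ (α.card : ℝ) ^ β.card * c α := by
            have := hsub α β hss.subset
            have h0 : 0 ≤ c β * b (α \ β) := mul_nonneg (hc0 _) (hb0 _)
            gcongr
    -- The leading `c α` is absorbed into the missing term `β = α`; for empty `α` this relies on `0
    -- ^ 0 = 1`.
    have hone : (1 : ℝ) ≤ (α.card : ℝ) ^ α.card := by
      rcases Nat.eq_zero_or_pos α.card with h | h
      · simp [h]
      · exact one_le_pow₀ (by exact_mod_cast h)
    have hpow : ((α.card : ℝ) + 1) ^ α.card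
        = (α.card : ℝ) ^ α.card + ∑ β ∈ α.ssubsets, (α.card : ℝ) ^ β.card := by
      have h1 := Finset.sum_pow_mul_eq_add_pow (α.card : ℝ) 1 α
      have h2 : α.powerset = insert α α.ssubsets := by
        rw [Finset.ssubsets, Finset.insert_erase (Finset.mem_powerset_self α)]
      rw [← h1, h2, Finset.sum_insert (by simp)]
      simp
    rw [cumulant_eq]
    calc |c α - ∑ β ∈ α.ssubsets, cumulant b c β * b (α \ β)|
        ≤ |c α| + |∑ β ∈ α.ssubsets, cumulant b c β * b (α \ β)| := abs_sub _ _
      _ ≤ c α + ∑ β ∈ α.ssubsets, (α.card : ℝ) ^ β.card * c α := by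
          rw [abs_of_nonneg (hc0 α)]
          gcongr
          exact (Finset.abs_sum_le_sum_abs _ _).trans (Finset.sum_le_sum hterm)
      _ = (1 + ∑ β ∈ α.ssubsets, (α.card : ℝ) ^ β.card) * c α := by
          rw [← Finset.sum_mul]; ring
      _ ≤ _ := by
          rw [hpow]
          have := hc0 α
          gcongr

/-! ### Cumulants of pair indicators: vanishing and size -/

/-- The cumulant of the membership indicator of `e₀` with the indicators of the pairs in `α`. -/
noncomputable def pairCumulant {n : ℕ} (k : ℕ) (e₀ : VertexPair n) (α : Finset (VertexPair n)) :
    ℝ :=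
  cumulant (monoProb k) (fun α => monoProb k (insert e₀ α)) α

theorem pairCumulant_empty {n k : ℕ} (hk : 1 ≤ k) (e₀ : VertexPair n) :
    pairCumulant k e₀ ∅ = 1 / (k : ℝ) := by
  have h : (∅ : Finset (VertexPair n)).ssubsets = ∅ := by simp [Finset.ssubsets]
  rw [pairCumulant, cumulant_eq, h, Finset.sum_empty, sub_zero, insert_empty_eq,
    monoProb_singleton hk]

theorem abs_pairCumulant_le {n k : ℕ} (hk : 1 ≤ k) (e₀ : VertexPair n)
    (α : Finset (VertexPair n)) :
    |pairCumulant k e₀ α| ≤ ((α.card : ℝ) + 1) ^ α.card * monoProb k (insert e₀ α) := by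
  refine abs_cumulant_le (monoProb_nonneg k) (fun _ => monoProb_nonneg k _) ?_ α
  intro α β h
  refine (monoProb_mul_le hk _ _).trans_eq ?_
  rw [Finset.insert_union, Finset.union_sdiff_of_subset h]

/-- The vertices touched by `α`. -/
def touched {n : ℕ} (α : Finset (VertexPair n)) : Finset (Fin n) :=
  α.image (fun e => e.1.1) ∪ α.image (fun e => e.1.2)

theorem mem_touched {n : ℕ} {α : Finset (VertexPair n)} {w : Fin n} :
    w ∈ touched α ↔ ∃ e ∈ α, e.1.1 = w ∨ e.1.2 = w := by
  simp only [touched, Finset.mem_union, Finset.mem_image]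
  grind

/-- If the cumulant does not vanish, `α` is connected to `e₀`. -/
theorem mem_of_pairCumulant_ne_zero {n k : ℕ} (hk : 1 ≤ k) {e₀ : VertexPair n}
    {α : Finset (VertexPair n)} (h : pairCumulant k e₀ α ≠ 0) (W : Finset (Fin n))
    (h1 : e₀.1.1 ∈ W) (h2 : e₀.1.2 ∈ W) (hW : ∀ e ∈ α, e.1.1 ∈ W ↔ e.1.2 ∈ W) :
    ∀ e ∈ α, e.1.1 ∈ W := by
  by_contra hcon
  push Not at hcon
  obtain ⟨e, he, heW⟩ := hcon
  -- `W` is a union of components containing `e₀`, so the pairs of `α` outside `W` form an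
  -- independent part.
  refine h (cumulant_eq_zero (α₂ := α.filter fun e => e.1.1 ∉ W) (monoProb_empty hk)
    ⟨e, by simp [he, heW]⟩ ?_ ?_)
  · intro γ hγ
    rw [← monoProb_union_of_separated hk W, Finset.sdiff_union_inter]
    · intro e he
      have := @hγ e
      have := hW e
      simp only [Finset.mem_sdiff, Finset.mem_filter] at he
      tauto
    · intro e he
      have := hW e
      simp only [Finset.mem_inter, Finset.mem_filter] at he
      tauto
  · intro γ hγ
    rw [← monoProb_union_of_separated hk W, Finset.insert_union, Finset.sdiff_union_inter]
    · intro e he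
      rcases Finset.mem_insert.1 he with rfl | he
      · exact ⟨h1, h2⟩
      have := @hγ e
      have := hW e
      simp only [Finset.mem_sdiff, Finset.mem_filter] at he
      tauto
    · intro e he
      have := hW e
      simp only [Finset.mem_inter, Finset.mem_filter] at he
      tauto

/-- If the cumulant of a nonempty set does not vanish, the set touches both ends of `e₀`. -/
theorem mem_touched_of_pairCumulant_ne_zero {n k : ℕ} (hk : 1 ≤ k) {e₀ : VertexPair n}
    {α : Finset (VertexPair n)} (hα : α.Nonempty) (h : pairCumulant k e₀ α ≠ 0) {w : Fin n}
    (hw : e₀.1.1 = w ∨ e₀.1.2 = w) : w ∈ touched α := by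
  by_contra hcon
  have hno : ∀ e ∈ α, e.1.1 ≠ w ∧ e.1.2 ≠ w := by
    intro e he
    by_contra h'
    exact hcon (mem_touched.2 ⟨e, he, by tauto⟩)
  -- If `α` misses an end of `e₀`, then `e₀` is pendant to every subset of `α`, so all of `α` splits
  -- off.
  refine h (cumulant_eq_zero (α₂ := α) (monoProb_empty hk) (by simpa using hα) ?_ ?_)
  · intro γ hγ
    rw [Finset.sdiff_eq_empty_iff_subset.2 hγ, Finset.inter_eq_left.2 hγ, monoProb_empty hk,
      one_mul]
  · intro γ hγ
    rw [Finset.sdiff_eq_empty_iff_subset.2 hγ, Finset.inter_eq_left.2 hγ,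
      monoProb_insert_pendant hk hw fun e he => hno e (hγ he), insert_empty_eq,
      monoProb_singleton hk, mul_comm]

/-- If the cumulant does not vanish, every vertex outside `e₀` has degree at least two. -/
theorem two_le_degree_of_pairCumulant_ne_zero {n k : ℕ} (hk : 1 ≤ k) {e₀ : VertexPair n}
    {α : Finset (VertexPair n)} (h : pairCumulant k e₀ α ≠ 0) {w : Fin n}
    (hw1 : e₀.1.1 ≠ w) (hw2 : e₀.1.2 ≠ w) (hw : w ∈ touched α) :
    2 ≤ (α.filter fun e => e.1.1 = w ∨ e.1.2 = w).card := by
  by_contra hcon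
  obtain ⟨e, he, hew⟩ := mem_touched.1 hw
  have hmem : e ∈ α.filter fun e => e.1.1 = w ∨ e.1.2 = w := by simp [he, hew]
  have huniq : ∀ e' ∈ α, e' ≠ e → e'.1.1 ≠ w ∧ e'.1.2 ≠ w := by
    intro e' he' hne
    by_contra h'
    have : e' ∈ α.filter fun e => e.1.1 = w ∨ e.1.2 = w := by
      rw [Finset.mem_filter]; tauto
    exact hne (Finset.card_le_one.1 (by omega) e' this e hmem)
  -- A pair pendant at a vertex outside `e₀` is independent of everything else, so it splits off
  -- alone.
  refine h (cumulant_eq_zero (α₂ := {e}) (monoProb_empty hk) ⟨e, by simp [he]⟩ ?_ ?_)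
  · intro γ hγ
    by_cases heγ : e ∈ γ
    · rw [Finset.inter_singleton_of_mem heγ, monoProb_singleton hk,
        ← monoProb_insert_pendant hk hew, Finset.sdiff_singleton_eq_erase,
        Finset.insert_erase heγ]
      intro e' he'
      simp only [Finset.mem_sdiff, Finset.mem_singleton] at he'
      exact huniq e' (hγ he'.1) he'.2
    · rw [Finset.inter_singleton_of_notMem heγ, Finset.sdiff_singleton_eq_erase,
        Finset.erase_eq_of_notMem heγ, monoProb_empty hk, mul_one]
  · intro γ hγ
    by_cases heγ : e ∈ γ
    · rw [Finset.inter_singleton_of_mem heγ, monoProb_singleton hk,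
        ← monoProb_insert_pendant hk hew, Finset.sdiff_singleton_eq_erase, Finset.insert_comm,
        Finset.insert_erase heγ]
      intro e' he'
      rcases Finset.mem_insert.1 he' with rfl | he'
      · exact ⟨hw1, hw2⟩
      simp only [Finset.mem_sdiff, Finset.mem_singleton] at he'
      exact huniq e' (hγ he'.1) he'.2
    · rw [Finset.inter_singleton_of_notMem heγ, Finset.sdiff_singleton_eq_erase,
        Finset.erase_eq_of_notMem heγ, monoProb_empty hk, mul_one]

/-- The vertices touched by `α` that are not ends of `e₀`. -/
def outerVertices {n : ℕ} (e₀ : VertexPair n) (α : Finset (VertexPair n)) : Finset (Fin n) :=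
  touched α \ {e₀.1.1, e₀.1.2}

/-- Handshake count: degrees sum to at most `2|α|`, outer vertices contribute at least two each, and
the two ends of `e₀` at least one each, so `2|U| + 2 ≤ 2|α|`. -/
theorem card_outerVertices_lt {n k : ℕ} (hk : 1 ≤ k) {e₀ : VertexPair n}
    {α : Finset (VertexPair n)} (hα : α.Nonempty) (h : pairCumulant k e₀ α ≠ 0) :
    (outerVertices e₀ α).card < α.card := by
  set U := outerVertices e₀ α with hU
  let r : VertexPair n → Fin n → Prop := fun e w => e.1.1 = w ∨ e.1.2 = w
  have hdisj : Disjoint U {e₀.1.1, e₀.1.2} := Finset.sdiff_disjoint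
  have hcount := Finset.sum_card_bipartiteAbove_eq_sum_card_bipartiteBelow r
    (s := α) (t := U ∪ {e₀.1.1, e₀.1.2})
  have hup : ∑ e ∈ α, (Finset.bipartiteAbove r (U ∪ {e₀.1.1, e₀.1.2}) e).card ≤ α.card * 2 := by
    rw [← smul_eq_mul]
    refine Finset.sum_le_card_nsmul _ _ _ fun e _ => ?_
    refine (Finset.card_le_card (t := {e.1.1, e.1.2}) ?_).trans Finset.card_le_two
    intro w hw
    have := (Finset.mem_bipartiteAbove r).1 hw
    simp only [Finset.mem_insert, Finset.mem_singleton]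
    rcases this.2 with h | h <;> simp [h]
  have hlow1 : U.card * 2 ≤ ∑ w ∈ U, (Finset.bipartiteBelow r α w).card := by
    rw [← smul_eq_mul]
    refine Finset.card_nsmul_le_sum _ _ _ fun w hw => ?_
    simp only [hU, outerVertices, Finset.mem_sdiff, Finset.mem_insert, Finset.mem_singleton,
      not_or] at hw
    exact two_le_degree_of_pairCumulant_ne_zero hk h (Ne.symm hw.2.1) (Ne.symm hw.2.2) hw.1
  have hpos : ∀ w, (e₀.1.1 = w ∨ e₀.1.2 = w) → 1 ≤ (Finset.bipartiteBelow r α w).card := by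
    intro w hw
    obtain ⟨e, he, hew⟩ := mem_touched.1 (mem_touched_of_pairCumulant_ne_zero hk hα h hw)
    exact Finset.card_pos.2 ⟨e, (Finset.mem_bipartiteBelow r).2 ⟨he, hew⟩⟩
  rw [hcount, Finset.sum_union hdisj, Finset.sum_pair e₀.2.ne] at hup
  have h1 := hpos _ (Or.inl rfl)
  have h2 := hpos _ (Or.inr rfl)
  omega

theorem abs_pairCumulant_le_pow {n k : ℕ} (hk : 1 ≤ k) {e₀ : VertexPair n}
    {α : Finset (VertexPair n)} (h : pairCumulant k e₀ α ≠ 0) :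
    |pairCumulant k e₀ α|
      ≤ ((α.card : ℝ) + 1) ^ α.card * (1 / (k : ℝ)) ^ ((outerVertices e₀ α).card + 1) := by
  refine (abs_pairCumulant_le hk e₀ α).trans ?_
  gcongr
  have hj : e₀.1.2 ∉ outerVertices e₀ α := by simp [outerVertices]
  -- The extra factor `1/k` comes from the second end of `e₀`, whose label is forced along with
  -- those of the outer vertices.
  rw [← Finset.card_insert_of_notMem hj]
  refine monoProb_le_of_forces_const hk (i := e₀.1.1) ?_ ?_
  · simp [outerVertices, e₀.2.ne]
  · intro z hz j hjU
    have h0 := hz e₀ (Finset.mem_insert_self _ _)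
    rcases Finset.mem_insert.1 hjU with rfl | hjU
    · exact h0.symm
    have hα : ∀ e ∈ α, z e.1.1 = z e.1.2 := fun e he => hz e (Finset.mem_insert_of_mem he)
    -- Taking `W` to be the color class of `e₀` uses connectivity without any paths: no pair of `α`
    -- crosses the class, so all of `α` lies in it.
    have hmem := mem_of_pairCumulant_ne_zero hk h (Finset.univ.filter fun j => z j = z e₀.1.1)
      (by simp) (by simp [h0]) (fun e he => by simp [hα e he])
    obtain ⟨e, he, hej⟩ := mem_touched.1 (Finset.mem_sdiff.1 hjU).1
    have := hmem e he
    simp only [Finset.mem_filter, Finset.mem_univ, true_and] at this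
    rcases hej with rfl | rfl
    · exact this
    · rw [← hα e he, this]

/-! ### Counting edge sets and summing squared cumulants -/

/-- The pairs with both ends in `W`. -/
def pairsWithin {n : ℕ} (W : Finset (Fin n)) : Finset (VertexPair n) :=
  Finset.univ.filter fun e => e.1.1 ∈ W ∧ e.1.2 ∈ W

theorem card_pairsWithin {n : ℕ} (W : Finset (Fin n)) :
    (pairsWithin W).card = W.card.choose 2 := by
  rw [← Finset.card_powersetCard]
  refine Finset.card_bij (fun e _ => {e.1.1, e.1.2}) ?_ ?_ ?_
  · intro e he
    simp only [pairsWithin, Finset.mem_filter, Finset.mem_univ, true_and] at he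
    rw [Finset.mem_powersetCard]
    refine ⟨?_, Finset.card_pair e.2.ne⟩
    simp [Finset.insert_subset_iff, he]
  · rintro ⟨⟨a, b⟩, hab⟩ _ ⟨⟨c, d⟩, hcd⟩ _ h
    simp only [Finset.ext_iff, Finset.mem_insert, Finset.mem_singleton] at h hab hcd
    have h1 := (h a).1 (Or.inl rfl)
    have h2 := (h b).1 (Or.inr rfl)
    have : a = c ∧ b = d := by
      simp only [Fin.ext_iff] at *
      omega
    simp [this]
  · intro s hs
    rw [Finset.mem_powersetCard] at hs
    obtain ⟨hsW, hs2⟩ := hs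
    obtain ⟨a, b, hab, rfl⟩ := Finset.card_eq_two.1 hs2
    have ha : a ∈ W := hsW (by simp)
    have hb : b ∈ W := hsW (by simp)
    rcases lt_or_gt_of_ne hab with h | h
    · exact ⟨⟨(a, b), h⟩, by simp [pairsWithin, ha, hb], rfl⟩
    · exact ⟨⟨(b, a), h⟩, by simp [pairsWithin, ha, hb], Finset.pair_comm _ _⟩

theorem card_vertexPair (n : ℕ) : Fintype.card (VertexPair n) = n.choose 2 := by
  have := card_pairsWithin (Finset.univ : Finset (Fin n))
  simpa [pairsWithin] using this

theorem card_pairsWithin_le {n d : ℕ} (hd : 1 ≤ d) {W : Finset (Fin n)} (hW : W.card ≤ d + 1) :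
    (pairsWithin W).card ≤ d ^ 2 := by
  rw [card_pairsWithin]
  refine (Nat.choose_le_choose 2 hW).trans ?_
  rw [Nat.choose_two_right, Nat.add_sub_cancel]
  exact Nat.div_le_of_le_mul (by nlinarith)

/-- Union bound over the set `U` of outer vertices: at most `n^m` choices of `U`, then at most
`(d²)^d` sets of `d` pairs on `U` and the ends of `e₀`. -/
theorem sum_sq_pairCumulant_le {n k d : ℕ} (hk : 1 ≤ k) (hd : 1 ≤ d) (e₀ : VertexPair n) :
    ∑ α ∈ Finset.powersetCard d Finset.univ, pairCumulant k e₀ α ^ 2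
      ≤ ∑ m ∈ Finset.range d, (n : ℝ) ^ m * (((d : ℝ) ^ 2) ^ d *
          (((d : ℝ) + 1) ^ d * (1 / (k : ℝ)) ^ (m + 1)) ^ 2) := by
  set B : ℕ → ℝ := fun m => (((d : ℝ) + 1) ^ d * (1 / (k : ℝ)) ^ (m + 1)) ^ 2 with hB
  have hB0 : ∀ m, 0 ≤ B m := fun m => sq_nonneg _
  let W : Finset (Fin n) → Finset (Fin n) := fun U => U ∪ {e₀.1.1, e₀.1.2}
  have hpt : ∀ α ∈ Finset.powersetCard d (Finset.univ : Finset (VertexPair n)),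
      pairCumulant k e₀ α ^ 2 ≤ ∑ m ∈ Finset.range d,
        ∑ U ∈ Finset.powersetCard m (Finset.univ : Finset (Fin n)),
          if α ⊆ pairsWithin (W U) then B m else 0 := by
    intro α hα
    have hαd := (Finset.mem_powersetCard.1 hα).2
    have hnn : ∀ m ∈ Finset.range d, 0 ≤
        ∑ U ∈ Finset.powersetCard m (Finset.univ : Finset (Fin n)),
          if α ⊆ pairsWithin (W U) then B m else 0 := fun m _ =>
      Finset.sum_nonneg fun U _ => by split_ifs; exacts [hB0 m, le_rfl]
    by_cases h : pairCumulant k e₀ α = 0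
    · rw [h, zero_pow two_ne_zero]
      exact Finset.sum_nonneg hnn
    have hne : α.Nonempty := Finset.card_pos.1 (by omega)
    have hlt := card_outerVertices_lt hk hne h
    rw [hαd] at hlt
    refine le_trans ?_ (Finset.single_le_sum hnn (Finset.mem_range.2 hlt))
    refine le_trans ?_ (Finset.single_le_sum (f := fun U => if α ⊆ pairsWithin (W U) then
      B (outerVertices e₀ α).card else 0) (fun U _ => by split_ifs; exacts [hB0 _, le_rfl])
      (Finset.mem_powersetCard.2 ⟨Finset.subset_univ (outerVertices e₀ α), rfl⟩))
    have hsub : α ⊆ pairsWithin (W (outerVertices e₀ α)) := by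
      intro e he
      have ht : ∀ w, (e.1.1 = w ∨ e.1.2 = w) → w ∈ touched α := fun w hw =>
        mem_touched.2 ⟨e, he, hw⟩
      have h1 := ht _ (Or.inl rfl)
      have h2 := ht _ (Or.inr rfl)
      simp only [pairsWithin, W, outerVertices, Finset.sdiff_union_self_eq_union,
        Finset.mem_filter, Finset.mem_univ, true_and]
      exact ⟨Finset.mem_union_left _ h1, Finset.mem_union_left _ h2⟩
    simp only [if_pos hsub, hB]
    rw [← sq_abs]
    have := abs_pairCumulant_le_pow hk h
    rw [hαd] at this
    gcongr
  refine (Finset.sum_le_sum hpt).trans ?_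
  rw [Finset.sum_comm]
  refine Finset.sum_le_sum fun m hm => ?_
  rw [Finset.sum_comm]
  have hm' := Finset.mem_range.1 hm
  have hU : ∀ U ∈ Finset.powersetCard m (Finset.univ : Finset (Fin n)),
      (∑ α ∈ Finset.powersetCard d (Finset.univ : Finset (VertexPair n)),
        if α ⊆ pairsWithin (W U) then B m else 0) ≤ ((d : ℝ) ^ 2) ^ d * B m := by
    intro U hU
    have hUc := (Finset.mem_powersetCard.1 hU).2
    -- Here `m < d` is used: `m + 2 ≤ d + 1`.
    have hWc : (W U).card ≤ d + 1 := by
      have h1 := Finset.card_union_le U {e₀.1.1, e₀.1.2}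
      have h2 := Finset.card_le_two (a := e₀.1.1) (b := e₀.1.2)
      simp only [W]
      omega
    have hfil : (Finset.powersetCard d (Finset.univ : Finset (VertexPair n))).filter
        (fun α => α ⊆ pairsWithin (W U)) = Finset.powersetCard d (pairsWithin (W U)) := by
      ext α
      simp [Finset.mem_powersetCard, and_comm]
    rw [← Finset.sum_filter, hfil, Finset.sum_const, Finset.card_powersetCard, nsmul_eq_mul]
    refine mul_le_mul_of_nonneg_right ?_ (hB0 m)
    have h1 : (pairsWithin (W U)).card.choose d ≤ (d ^ 2) ^ d :=
      (Nat.choose_le_pow _ _).trans (Nat.pow_le_pow_left (card_pairsWithin_le hd hWc) d)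
    exact_mod_cast h1
  refine (Finset.sum_le_card_nsmul _ _ _ hU).trans ?_
  rw [nsmul_eq_mul, Finset.card_powersetCard, Finset.card_univ, Fintype.card_fin]
  have h1 : ((n.choose m : ℕ) : ℝ) ≤ (n : ℝ) ^ m := by exact_mod_cast Nat.choose_le_pow n m
  have := hB0 m
  gcongr

theorem sum_coe_mul_geometric_le {r : ℝ} (hr0 : 0 < r) (hr1 : r < 1) (s : Finset ℕ) :
    ∑ d ∈ s, (d : ℝ) * r ^ d ≤ r / (1 - r) ^ 2 := by
  have h := hasSum_coe_mul_geometric_of_norm_lt_one (r := r)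
    (by rwa [Real.norm_eq_abs, abs_of_pos hr0])
  exact sum_le_hasSum s (fun d _ => by positivity) h

/-- The bound on the degree-`D` correlation. -/
theorem sum_sq_pairCumulant_mul_le {n k D : ℕ} (hn : 2 ≤ n) (hk : 1 ≤ k) (hD : 1 ≤ D)
    {r s : ℝ} (hr0 : 0 < r) (hr1 : r < 1) (hs0 : 0 ≤ s)
    (hs : s ≤ r / ((D : ℝ) * ((D : ℝ) + 1)) ^ 2 * min ((k : ℝ) ^ 2 / (n : ℝ)) 1)
    (e₀ : VertexPair n) :
    ∑ α ∈ Finset.univ.filter (fun α : Finset (VertexPair n) => α.card ≤ D),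
        pairCumulant k e₀ α ^ 2 * s ^ α.card
      ≤ 1 / (k : ℝ) ^ 2 + r / ((1 - r) ^ 2 * (n : ℝ)) := by
  have hk' : (0 : ℝ) < k := by exact_mod_cast hk
  have hn' : (0 : ℝ) < n := by exact_mod_cast (by omega : 0 < n)
  have hD' : (0 : ℝ) < D := by exact_mod_cast hD
  set μ := min ((k : ℝ) ^ 2 / (n : ℝ)) 1 with hμ
  have hμ0 : 0 ≤ μ := le_min (by positivity) zero_le_one
  have hlevel : ∀ d ∈ Finset.Icc 1 D,
      ∑ α ∈ Finset.powersetCard d Finset.univ, pairCumulant k e₀ α ^ 2 * s ^ α.card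
        ≤ (1 / (n : ℝ)) * ((d : ℝ) * r ^ d) := by
    intro d hd
    obtain ⟨hd1, hdD⟩ := Finset.mem_Icc.1 hd
    have hd' : (0 : ℝ) < d := by exact_mod_cast hd1
    have hdD' : (d : ℝ) ≤ D := by exact_mod_cast hdD
    have h1 : ∑ α ∈ Finset.powersetCard d Finset.univ, pairCumulant k e₀ α ^ 2 * s ^ α.card
        = (∑ α ∈ Finset.powersetCard d Finset.univ, pairCumulant k e₀ α ^ 2) * s ^ d := by
      rw [Finset.sum_mul]
      exact Finset.sum_congr rfl fun α hα => by rw [(Finset.mem_powersetCard.1 hα).2]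
    have hsd : s ≤ r / ((d : ℝ) * ((d : ℝ) + 1)) ^ 2 * μ := by
      refine hs.trans ?_
      gcongr
    have h2 : s ^ d ≤ r ^ d / (((d : ℝ) ^ 2) ^ d * (((d : ℝ) + 1) ^ d) ^ 2) * μ ^ d := by
      refine (pow_le_pow_left₀ hs0 hsd d).trans_eq ?_
      rw [mul_pow, div_pow, mul_pow, mul_pow, ← pow_mul ((d : ℝ) + 1), mul_comm 2 d,
        pow_mul ((d : ℝ) + 1)]
    rw [h1]
    refine (mul_le_mul_of_nonneg_right (sum_sq_pairCumulant_le hk hd1 e₀)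
      (by positivity)).trans ?_
    rw [Finset.sum_mul]
    have h3 : ∀ m ∈ Finset.range d, (n : ℝ) ^ m * (((d : ℝ) ^ 2) ^ d *
          (((d : ℝ) + 1) ^ d * (1 / (k : ℝ)) ^ (m + 1)) ^ 2) * s ^ d ≤ 1 / (n : ℝ) * r ^ d := by
      intro m hm
      have hm' : m + 1 ≤ d := Finset.mem_range.1 hm
      -- Of the `d` factors `μ`, spend `m + 1` as `k²/n`, to cancel `n^m k^{-2(m+1)}` up to `1/n`,
      -- and bound the others by `1`. This is where the minimum with `1` is needed.
      have hμd : μ ^ d ≤ ((k : ℝ) ^ 2 / (n : ℝ)) ^ (m + 1) :=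
        (pow_le_pow_of_le_one hμ0 (min_le_right _ _) hm').trans
          (pow_le_pow_left₀ hμ0 (min_le_left _ _) _)
      calc _ ≤ (n : ℝ) ^ m * (((d : ℝ) ^ 2) ^ d *
            (((d : ℝ) + 1) ^ d * (1 / (k : ℝ)) ^ (m + 1)) ^ 2) *
            (r ^ d / (((d : ℝ) ^ 2) ^ d * (((d : ℝ) + 1) ^ d) ^ 2) *
              ((k : ℝ) ^ 2 / (n : ℝ)) ^ (m + 1)) := by
            refine mul_le_mul_of_nonneg_left (h2.trans ?_) (by positivity)
            gcongr
        _ = 1 / (n : ℝ) * r ^ d := by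
            have hA : ((d : ℝ) ^ 2) ^ d ≠ 0 := by positivity
            have hB : ((d : ℝ) + 1) ^ d ≠ 0 := by positivity
            have hC : (k : ℝ) ^ (m + 1) ≠ 0 := by positivity
            rw [div_pow ((k : ℝ) ^ 2), one_div_pow, pow_succ (n : ℝ) m, pow_right_comm (k : ℝ)]
            generalize ((d : ℝ) ^ 2) ^ d = A at hA ⊢
            generalize ((d : ℝ) + 1) ^ d = B at hB ⊢
            generalize (k : ℝ) ^ (m + 1) = C at hC ⊢
            field_simp
    refine (Finset.sum_le_card_nsmul _ _ _ h3).trans_eq ?_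
    rw [Finset.card_range, nsmul_eq_mul]
    ring
  have hsplit : ∑ α ∈ Finset.univ.filter (fun α : Finset (VertexPair n) => α.card ≤ D),
        pairCumulant k e₀ α ^ 2 * s ^ α.card
      = ∑ d ∈ Finset.range (D + 1), ∑ α ∈ Finset.powersetCard d Finset.univ,
          pairCumulant k e₀ α ^ 2 * s ^ α.card := by
    rw [← Finset.sum_fiberwise_of_maps_to (t := Finset.range (D + 1)) (g := Finset.card)
      (fun α hα => Finset.mem_range.2 (Nat.lt_succ_of_le (Finset.mem_filter.1 hα).2))]
    refine Finset.sum_congr rfl fun d hd => Finset.sum_congr ?_ fun _ _ => rfl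
    ext α
    have := Finset.mem_range.1 hd
    simp only [Finset.mem_filter, Finset.mem_univ, true_and, Finset.mem_powersetCard,
      Finset.subset_univ]
    omega
  have hrange : Finset.range (D + 1) = insert 0 (Finset.Icc 1 D) := by
    ext d
    simp only [Finset.mem_range, Finset.mem_insert, Finset.mem_Icc]
    omega
  rw [hsplit, hrange, Finset.sum_insert (by simp)]
  refine add_le_add ?_ ((Finset.sum_le_sum hlevel).trans ?_)
  · simp [pairCumulant_empty hk]
  · rw [← Finset.mul_sum]
    refine (mul_le_mul_of_nonneg_left (sum_coe_mul_geometric_le hr0 hr1 _)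
      (by positivity)).trans_eq ?_
    rw [div_mul_div_comm, one_mul, mul_comm (n : ℝ)]

/-! ### Orthogonal expansion for independent edges -/

/-- Value of an indicator bit. -/
def bit (b : Bool) : ℝ := if b then 1 else 0

/-- Weight of `y` under independent Bernoulli variables with means `m`. -/
def bernoulliWeight {E : Type*} [Fintype E] (m : E → ℝ) (y : E → Bool) : ℝ :=
  ∏ e, if y e then m e else 1 - m e

theorem bernoulli_orthogonal {E : Type*} [Fintype E] [DecidableEq E] (m : E → ℝ)
    (α β : Finset E) :
    ∑ y, bernoulliWeight m y * ((∏ e ∈ α, (bit (y e) - m e)) * ∏ e ∈ β, (bit (y e) - m e))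
      = if α = β then ∏ e ∈ α, m e * (1 - m e) else 0 := by
  have h := Fintype.prod_sum (fun (e : E) (b : Bool) => (if b then m e else 1 - m e) *
    ((if e ∈ α then bit b - m e else 1) * (if e ∈ β then bit b - m e else 1)))
  have hl : ∀ y : E → Bool, bernoulliWeight m y *
      ((∏ e ∈ α, (bit (y e) - m e)) * ∏ e ∈ β, (bit (y e) - m e))
      = ∏ e, (if y e then m e else 1 - m e) *
        ((if e ∈ α then bit (y e) - m e else 1) * (if e ∈ β then bit (y e) - m e else 1)) := by
    intro y
    rw [Finset.prod_mul_distrib, Finset.prod_mul_distrib, Finset.prod_ite_mem,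
      Finset.prod_ite_mem, Finset.univ_inter, Finset.univ_inter, bernoulliWeight]
  simp only [hl]
  rw [← h]
  have hf : ∀ e, (∑ b : Bool, (if b then m e else 1 - m e) *
      ((if e ∈ α then bit b - m e else 1) * (if e ∈ β then bit b - m e else 1)))
      = if (e ∈ α ↔ e ∈ β) then (if e ∈ α then m e * (1 - m e) else 1) else 0 := by
    intro e
    by_cases ha : e ∈ α <;> by_cases hb : e ∈ β <;> simp [ha, hb, bit] <;> ring
  simp only [hf]
  rw [Finset.prod_ite_zero, Finset.prod_ite_mem, Finset.univ_inter]
  simp only [Finset.mem_univ, true_implies, Finset.ext_iff]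

theorem bernoulli_sum_expansion {E : Type*} [Fintype E] [DecidableEq E] (m : E → ℝ)
    (h : Finset E → ℝ) :
    ∑ y, bernoulliWeight m y * ∑ β, h β * ∏ e ∈ β, (bit (y e) - m e) = h ∅ := by
  have h0 : ∀ β : Finset E, ∑ y, bernoulliWeight m y * ∏ e ∈ β, (bit (y e) - m e)
      = if β = ∅ then 1 else 0 := by
    intro β
    have := bernoulli_orthogonal m β ∅
    simp only [Finset.prod_empty, mul_one] at this
    rw [this]
    split_ifs with hβ
    · rw [hβ, Finset.prod_empty]
    · rfl
  simp only [Finset.mul_sum]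
  rw [Finset.sum_comm]
  simp only [mul_left_comm _ (h _), ← Finset.mul_sum, h0]
  simp

theorem bernoulli_sum_sq_expansion {E : Type*} [Fintype E] [DecidableEq E] (m : E → ℝ)
    (h : Finset E → ℝ) :
    ∑ y, bernoulliWeight m y * (∑ β, h β * ∏ e ∈ β, (bit (y e) - m e)) ^ 2
      = ∑ β, h β ^ 2 * ∏ e ∈ β, m e * (1 - m e) := by
  have h1 : ∀ y : E → Bool, bernoulliWeight m y * (∑ β, h β * ∏ e ∈ β, (bit (y e) - m e)) ^ 2
      = ∑ β, ∑ γ, h β * h γ * (bernoulliWeight m y *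
        ((∏ e ∈ β, (bit (y e) - m e)) * ∏ e ∈ γ, (bit (y e) - m e))) := by
    intro y
    rw [sq, Finset.sum_mul_sum, Finset.mul_sum]
    refine Finset.sum_congr rfl fun β _ => ?_
    rw [Finset.mul_sum]
    refine Finset.sum_congr rfl fun γ _ => by ring
  simp only [h1]
  rw [Finset.sum_comm]
  refine Finset.sum_congr rfl fun β _ => ?_
  rw [Finset.sum_comm]
  simp only [← Finset.mul_sum, bernoulli_orthogonal]
  simp [sq]

/-! ### Recentring at the edge means and the risk of one pair -/

/-- Edge means under the stochastic block model. -/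
def edgeMean {n k : ℕ} (p q : ℝ) (z : Fin n → Fin k) (e : VertexPair n) : ℝ :=
  q + (p - q) * if z e.1.1 = z e.1.2 then 1 else 0

theorem graphProb_connMatrix {n k : ℕ} (p q : ℝ) (z : Fin n → Fin k) (y : VertexPair n → Bool) :
    graphProb (connMatrix p q z) y = bernoulliWeight (edgeMean p q z) y := by
  have : ∀ e : VertexPair n, connMatrix p q z e.1.1 e.1.2 = edgeMean p q z e := by
    intro e
    by_cases h : z e.1.1 = z e.1.2 <;> simp [connMatrix, edgeMean, e.2.ne, h]
  simp only [graphProb, bernoulliWeight, this]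

theorem edgeMean_variance_ge {n k : ℕ} {p q : ℝ} (hq : 0 < q) (hqp : q < p) (hp : p < 1)
    (z : Fin n → Fin k) (e : VertexPair n) :
    q * (1 - p) ≤ edgeMean p q z e * (1 - edgeMean p q z e) := by
  rw [edgeMean]
  split_ifs <;> nlinarith

/-- The coefficients, around the edge means, of a polynomial expanded around `q`. -/
noncomputable def recentred {n k : ℕ} (p q : ℝ) (s : Finset (Finset (VertexPair n)))
    (a : Finset (VertexPair n) → ℝ) (z : Fin n → Fin k) (β : Finset (VertexPair n)) : ℝ :=
  ∑ α ∈ s, if β ⊆ α then a α * ((p - q) ^ (α \ β).card * monoInd (α \ β) z) else 0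

theorem sum_eq_sum_recentred {n k : ℕ} (p q : ℝ) (s : Finset (Finset (VertexPair n)))
    (a : Finset (VertexPair n) → ℝ) (z : Fin n → Fin k) (y : VertexPair n → Bool) :
    ∑ α ∈ s, a α * ∏ e ∈ α, (bit (y e) - q)
      = ∑ β, recentred p q s a z β * ∏ e ∈ β, (bit (y e) - edgeMean p q z e) := by
  simp only [recentred, Finset.sum_mul]
  rw [Finset.sum_comm]
  refine Finset.sum_congr rfl fun α _ => ?_
  have h1 : ∏ e ∈ α, (bit (y e) - q) = ∏ e ∈ α, ((bit (y e) - edgeMean p q z e) +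
      (p - q) * if z e.1.1 = z e.1.2 then 1 else 0) :=
    Finset.prod_congr rfl fun e _ => by rw [edgeMean]; ring
  rw [h1, Finset.prod_add, Finset.mul_sum]
  have h2 : α.powerset = Finset.univ.filter fun β => β ⊆ α := by ext; simp
  rw [h2, Finset.sum_filter]
  refine Finset.sum_congr rfl fun β _ => ?_
  split_ifs
  · rw [Finset.prod_mul_distrib, Finset.prod_const, monoInd]
    ring
  · rw [zero_mul]

theorem labelMean_recentred {n k : ℕ} (p q : ℝ) (s : Finset (Finset (VertexPair n)))
    (a : Finset (VertexPair n) → ℝ) (β : Finset (VertexPair n)) :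
    labelMean (k := k) (fun z => recentred p q s a z β)
      = ∑ α ∈ s, if β ⊆ α then a α * ((p - q) ^ (α \ β).card * monoProb k (α \ β)) else 0 := by
  simp only [recentred]
  rw [labelMean_sum]
  refine Finset.sum_congr rfl fun α _ => ?_
  split_ifs
  · rw [labelMean_mul_left, labelMean_mul_left, monoProb]
  · simp [labelMean]

/-- The correlation with the membership indicator, in terms of cumulants. -/
theorem labelMean_mono_mul_recentred {n k : ℕ} (hk : 1 ≤ k) (p q : ℝ)
    (s : Finset (Finset (VertexPair n))) (a : Finset (VertexPair n) → ℝ) (e₀ : VertexPair n) :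
    labelMean (k := k) (fun z => monoInd {e₀} z * recentred p q s a z ∅)
      = ∑ β, pairCumulant k e₀ β * (p - q) ^ β.card *
          labelMean (k := k) (fun z => recentred p q s a z β) := by
  have h1 : ∀ (z : Fin n → Fin k) (α : Finset (VertexPair n)),
      monoInd {e₀} z * monoInd α z = monoInd (insert e₀ α) z := by
    intro z α
    simp only [monoInd_eq, Finset.forall_mem_insert, Finset.mem_singleton, forall_eq]
    by_cases h : z e₀.1.1 = z e₀.1.2 <;> simp [h]
  have h2 : labelMean (k := k) (fun z => monoInd {e₀} z * recentred p q s a z ∅)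
      = ∑ α ∈ s, a α * ((p - q) ^ α.card * monoProb k (insert e₀ α)) := by
    have : ∀ z : Fin n → Fin k, monoInd {e₀} z * recentred p q s a z ∅
        = ∑ α ∈ s, a α * ((p - q) ^ α.card * monoInd (insert e₀ α) z) := by
      intro z
      rw [recentred, Finset.mul_sum]
      refine Finset.sum_congr rfl fun α _ => ?_
      rw [if_pos (Finset.empty_subset α), Finset.sdiff_empty, ← h1]
      ring
    simp only [this]
    rw [labelMean_sum]
    refine Finset.sum_congr rfl fun α _ => ?_
    rw [labelMean_mul_left, labelMean_mul_left, monoProb]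
  rw [h2]
  simp only [labelMean_recentred, Finset.mul_sum]
  rw [Finset.sum_comm]
  refine Finset.sum_congr rfl fun α _ => ?_
  -- The system defining the cumulants is exactly what makes this identity hold for every choice of
  -- coefficients `a`.
  rw [← sum_cumulant (b := monoProb k) (fun α => monoProb k (insert e₀ α)) (monoProb_empty hk) α]
  have h3 : α.powerset = Finset.univ.filter fun β => β ⊆ α := by ext; simp
  rw [h3, Finset.sum_filter, Finset.mul_sum, Finset.mul_sum]
  refine Finset.sum_congr rfl fun β _ => ?_
  split_ifs with hβ
  · have : (p - q) ^ α.card = (p - q) ^ β.card * (p - q) ^ (α \ β).card := by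
      rw [← pow_add, add_comm, Finset.card_sdiff_add_card_eq_card hβ]
    rw [this, pairCumulant]
    ring
  · simp

/-- The risk for one pair of an estimator expanded around `q`. -/
theorem pair_risk_ge {n k : ℕ} (hk : 1 ≤ k) {p q : ℝ} (hq : 0 < q) (hqp : q < p) (hp : p < 1)
    (D : ℕ) (a : Finset (VertexPair n) → ℝ) (e₀ : VertexPair n) :
    1 / (k : ℝ) - ∑ β ∈ Finset.univ.filter (fun β : Finset (VertexPair n) => β.card ≤ D),
        pairCumulant k e₀ β ^ 2 * ((p - q) ^ 2 / (q * (1 - p))) ^ β.card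
      ≤ labelMean (k := k) (fun z => ∑ y, bernoulliWeight (edgeMean p q z) y *
          (∑ α ∈ Finset.univ.filter (fun α : Finset (VertexPair n) => α.card ≤ D),
            a α * ∏ e ∈ α, (bit (y e) - q) - monoInd {e₀} z) ^ 2) := by
  set s := Finset.univ.filter (fun β : Finset (VertexPair n) => β.card ≤ D) with hs
  have hv : 0 < q * (1 - p) := mul_pos hq (by linarith)
  let H : Finset (VertexPair n) → ℝ := fun β =>
    labelMean (k := k) (fun z => recentred p q s a z β)
  have hH : ∀ β ∉ s, H β = 0 := by
    intro β hβ
    simp only [H, labelMean_recentred]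
    refine Finset.sum_eq_zero fun α hα => if_neg fun hsub => hβ ?_
    simp only [hs, Finset.mem_filter, Finset.mem_univ, true_and] at hα ⊢
    exact (Finset.card_le_card hsub).trans hα
  have hpt : ∀ z : Fin n → Fin k, ∑ y, bernoulliWeight (edgeMean p q z) y *
        (∑ α ∈ s, a α * ∏ e ∈ α, (bit (y e) - q) - monoInd {e₀} z) ^ 2
      = (∑ β, recentred p q s a z β ^ 2 * ∏ e ∈ β, edgeMean p q z e * (1 - edgeMean p q z e))
        + (-2) * (monoInd {e₀} z * recentred p q s a z ∅) + monoInd {e₀} z := by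
    intro z
    have hx : monoInd {e₀} z ^ 2 = monoInd {e₀} z := by
      rw [monoInd_eq]; split_ifs <;> norm_num
    have hone : ∑ y, bernoulliWeight (edgeMean p q z) y = 1 := by
      simpa using bernoulli_orthogonal (edgeMean p q z) ∅ ∅
    simp only [sum_eq_sum_recentred p q s a z]
    rw [← bernoulli_sum_sq_expansion]
    have hsum := bernoulli_sum_expansion (edgeMean p q z) (recentred p q s a z)
    have expand : ∀ y, bernoulliWeight (edgeMean p q z) y *
        (∑ β, recentred p q s a z β * ∏ e ∈ β, (bit (y e) - edgeMean p q z e)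
          - monoInd {e₀} z) ^ 2
        = bernoulliWeight (edgeMean p q z) y *
          (∑ β, recentred p q s a z β * ∏ e ∈ β, (bit (y e) - edgeMean p q z e)) ^ 2
          + (-2 * monoInd {e₀} z) * (bernoulliWeight (edgeMean p q z) y *
            ∑ β, recentred p q s a z β * ∏ e ∈ β, (bit (y e) - edgeMean p q z e))
          + monoInd {e₀} z * bernoulliWeight (edgeMean p q z) y := by
      intro y
      rw [sub_sq, hx]
      ring
    simp only [expand, Finset.sum_add_distrib, ← Finset.mul_sum, hsum, hone]
    ring
  have hadd : ∀ f g : (Fin n → Fin k) → ℝ,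
      labelMean (fun z => f z + g z) = labelMean f + labelMean g := by
    intro f g
    simp only [labelMean, Finset.sum_add_distrib, mul_add]
  -- Bound every conditional variance below by `q(1-p)`, then apply Jensen over the labels.
  have hsq : ∑ β ∈ s, (q * (1 - p)) ^ β.card * H β ^ 2 ≤ labelMean (k := k) (fun z =>
      ∑ β, recentred p q s a z β ^ 2 *
        ∏ e ∈ β, edgeMean p q z e * (1 - edgeMean p q z e)) := by
    rw [labelMean_sum]
    have hterm : ∀ β, (q * (1 - p)) ^ β.card * H β ^ 2 ≤ labelMean (k := k) (fun z =>
        recentred p q s a z β ^ 2 * ∏ e ∈ β, edgeMean p q z e * (1 - edgeMean p q z e)) := by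
      intro β
      refine (mul_le_mul_of_nonneg_left (sq_labelMean_le hk _) (by positivity)).trans ?_
      rw [← labelMean_mul_left]
      refine labelMean_mono fun z => ?_
      rw [mul_comm]
      refine mul_le_mul_of_nonneg_left ?_ (sq_nonneg _)
      rw [← Finset.prod_const]
      exact Finset.prod_le_prod (fun _ _ => hv.le)
        fun e _ => edgeMean_variance_ge hq hqp hp z e
    exact (Finset.sum_le_univ_sum_of_nonneg fun β => by positivity).trans
      (Finset.sum_le_sum fun β _ => hterm β)
  have hcor : ∑ β, pairCumulant k e₀ β * (p - q) ^ β.card * H β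
      = ∑ β ∈ s, pairCumulant k e₀ β * (p - q) ^ β.card * H β :=
    (Finset.sum_subset (Finset.subset_univ s) fun β _ hβ => by rw [hH β hβ, mul_zero]).symm
  have hmean : labelMean (k := k) (fun z : Fin n → Fin k => monoInd {e₀} z) = 1 / (k : ℝ) :=
    monoProb_singleton hk e₀
  simp only [hpt]
  rw [hadd, hadd, labelMean_mul_left, labelMean_mono_mul_recentred hk, hcor, hmean]
  -- Complete the square in each `H β` separately: `2uH - vH² ≤ u²/v`.
  have hfin : ∑ β ∈ s, (2 * (pairCumulant k e₀ β * (p - q) ^ β.card * H β)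
      - (q * (1 - p)) ^ β.card * H β ^ 2)
      ≤ ∑ β ∈ s, pairCumulant k e₀ β ^ 2 * ((p - q) ^ 2 / (q * (1 - p))) ^ β.card := by
    refine Finset.sum_le_sum fun β _ => ?_
    have hvb : 0 < (q * (1 - p)) ^ β.card := pow_pos hv _
    rw [div_pow, ← mul_div_assoc, le_div_iff₀ hvb, pow_right_comm (p - q)]
    nlinarith [sq_nonneg (pairCumulant k e₀ β * (p - q) ^ β.card
      - (q * (1 - p)) ^ β.card * H β)]
  rw [Finset.sum_sub_distrib, ← Finset.mul_sum] at hfin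
  linarith

/-! ### Reduction of polynomial estimators to multilinear form -/

/-- Functions of a graph that are polynomials of degree at most `d` in the edge indicators. -/
def lowDegree {n : ℕ} (q : ℝ) (d : ℕ) : Submodule ℝ ((VertexPair n → Bool) → ℝ) :=
  Submodule.span ℝ ((fun (α : Finset (VertexPair n)) y => ∏ e ∈ α, (bit (y e) - q)) ''
    (Finset.univ.filter (fun α : Finset (VertexPair n) => α.card ≤ d) : Finset _))

theorem prod_mem_lowDegree {n : ℕ} (q : ℝ) {d : ℕ} {α : Finset (VertexPair n)} (h : α.card ≤ d) :
    (fun y => ∏ e ∈ α, (bit (y e) - q)) ∈ lowDegree q d :=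
  Submodule.subset_span ⟨α, by simpa using h, rfl⟩

theorem edge_mul_mem_lowDegree {n : ℕ} {q : ℝ} {d : ℕ} (e : VertexPair n)
    {f : (VertexPair n → Bool) → ℝ} (hf : f ∈ lowDegree q d) :
    (fun y => bit (y e) * f y) ∈ lowDegree q (d + 1) := by
  induction hf using Submodule.span_induction with
  | mem f hf =>
    obtain ⟨α, hα, rfl⟩ := hf
    have hα' : α.card ≤ d := by simpa using hα
    have hmem := prod_mem_lowDegree q (Nat.le_succ_of_le hα')
    by_cases he : e ∈ α
    · have herase : (α.erase e).card ≤ d + 1 :=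
        (Finset.card_le_card (Finset.erase_subset e α)).trans (Nat.le_succ_of_le hα')
      convert Submodule.add_mem _ (Submodule.smul_mem _ (1 - q) hmem)
        (Submodule.smul_mem _ (q * (1 - q)) (prod_mem_lowDegree q herase)) using 1
      funext y
      simp only [Pi.add_apply, Pi.smul_apply, smul_eq_mul, ← Finset.mul_prod_erase α _ he]
      -- Since a bit is idempotent, multiplying by an edge already present needs no new factor.
      have : bit (y e) * (bit (y e) - q) = (1 - q) * (bit (y e) - q) + q * (1 - q) := by
        cases y e <;> simp [bit] <;> ring
      rw [← mul_assoc, this]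
      ring
    · have hins : (insert e α).card ≤ d + 1 :=
        (Finset.card_insert_le e α).trans (Nat.succ_le_succ hα')
      convert Submodule.add_mem _ (Submodule.smul_mem _ q hmem) (prod_mem_lowDegree q hins)
        using 1
      funext y
      simp only [Pi.add_apply, Pi.smul_apply, smul_eq_mul, Finset.prod_insert he]
      ring
  | zero =>
    convert Submodule.zero_mem (lowDegree (n := n) q (d + 1)) using 1
    funext y
    simp
  | add f g _ _ hf hg =>
    convert Submodule.add_mem _ hf hg using 1
    funext y
    simp [mul_add]
  | smul c f _ hf =>
    convert Submodule.smul_mem _ c hf using 1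
    funext y
    simp only [Pi.smul_apply, smul_eq_mul]
    ring

theorem lowDegree_mono {n : ℕ} (q : ℝ) {d d' : ℕ} (h : d ≤ d') :
    lowDegree (n := n) q d ≤ lowDegree q d' := by
  refine Submodule.span_mono (Set.image_mono ?_)
  intro α hα
  simp only [Finset.coe_filter, Finset.mem_univ, true_and, Set.mem_ofPred_eq] at hα ⊢
  omega

theorem entry_mul_mem_lowDegree {n : ℕ} {q : ℝ} {d : ℕ} (i j : Fin n)
    {f : (VertexPair n → Bool) → ℝ} (hf : f ∈ lowDegree q d) :
    (fun y => adjOfEdges y i j * f y) ∈ lowDegree q (d + 1) := by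
  rcases lt_trichotomy i j with h | h | h
  · simpa [adjOfEdges, h, bit] using edge_mul_mem_lowDegree ⟨(i, j), h⟩ hf
  · have : (fun y : VertexPair n → Bool => adjOfEdges y i j * f y) = 0 := by
      funext y; simp [adjOfEdges, h]
    rw [this]
    exact Submodule.zero_mem _
  · simpa [adjOfEdges, h, h.not_gt, bit] using edge_mul_mem_lowDegree ⟨(j, i), h⟩ hf

theorem entry_pow_mul_mem_lowDegree {n : ℕ} {q : ℝ} {d : ℕ} (i j : Fin n) (m : ℕ)
    {f : (VertexPair n → Bool) → ℝ} (hf : f ∈ lowDegree q d) :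
    (fun y => adjOfEdges y i j ^ m * f y) ∈ lowDegree q (m + d) := by
  induction m with
  | zero => simpa using hf
  | succ m ih =>
    have := entry_mul_mem_lowDegree i j ih
    simp only [← mul_assoc, ← pow_succ'] at this
    rwa [add_right_comm]

theorem monomial_mem_lowDegree {n : ℕ} (q : ℝ) (m : Fin n × Fin n → ℕ)
    (s : Finset (Fin n × Fin n)) :
    (fun y => ∏ e ∈ s, adjOfEdges y e.1 e.2 ^ m e) ∈ lowDegree q (∑ e ∈ s, m e) := by
  induction s using Finset.induction_on with
  | empty => simpa using prod_mem_lowDegree (n := n) q (d := 0) (α := ∅) (by simp)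
  | insert e s he ih =>
    simp only [Finset.prod_insert he, Finset.sum_insert he]
    exact entry_pow_mul_mem_lowDegree e.1 e.2 (m e) ih

theorem eval_mem_lowDegree {n D : ℕ} (q : ℝ) {P : MvPolynomial (Fin n × Fin n) ℝ}
    (hP : P.totalDegree ≤ D) :
    (fun y => MvPolynomial.eval (fun e => adjOfEdges y e.1 e.2) P) ∈ lowDegree q D := by
  have : (fun y : VertexPair n → Bool => MvPolynomial.eval (fun e => adjOfEdges y e.1 e.2) P)
      = ∑ m ∈ P.support, P.coeff m •
        fun y : VertexPair n → Bool => ∏ e ∈ m.support, adjOfEdges y e.1 e.2 ^ m e := by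
    funext y
    simp [MvPolynomial.eval_eq]
  rw [this]
  refine Submodule.sum_mem _ fun m hm => Submodule.smul_mem _ _ ?_
  exact lowDegree_mono q ((MvPolynomial.le_totalDegree hm).trans hP)
    (monomial_mem_lowDegree q m m.support)

theorem exists_coeff_of_mem_lowDegree {n D : ℕ} {q : ℝ} {f : (VertexPair n → Bool) → ℝ}
    (hf : f ∈ lowDegree q D) : ∃ a : Finset (VertexPair n) → ℝ, ∀ y, f y =
      ∑ α ∈ Finset.univ.filter (fun α : Finset (VertexPair n) => α.card ≤ D),
        a α * ∏ e ∈ α, (bit (y e) - q) := by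
  obtain ⟨a, rfl⟩ := (Submodule.mem_span_image_finset_iff_exists_fun' ℝ).1 hf
  exact ⟨a, fun y => by simp⟩

/-! ### Averaging over pairs and conclusion -/

theorem clusteringRisk_eq {n : ℕ} (k : ℕ) {p q : ℝ} (hqp : q < p) (P : PolyEstimator n) :
    clusteringRisk k p q P = 1 / (n.choose 2 : ℝ) * ∑ e₀ : VertexPair n,
      labelMean (k := k) (fun z => ∑ y, bernoulliWeight (edgeMean p q z) y *
        (P.evalAt (adjOfEdges y) e₀.1.1 e₀.1.2 - monoInd {e₀} z) ^ 2) := by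
  rw [← labelMean_sum, ← labelMean_mul_left, clusteringRisk, sbmExpectation, labelMean,
    Finset.mul_sum]
  refine Finset.sum_congr rfl fun z _ => ?_
  congr 1
  rw [Finset.sum_comm, Finset.mul_sum]
  refine Finset.sum_congr rfl fun y _ => ?_
  rw [graphProb_connMatrix, pairLoss, ← Finset.mul_sum, mul_left_comm]
  congr 2
  refine Finset.sum_congr rfl fun e₀ _ => ?_
  rw [membershipMatrix_connMatrix hqp, if_neg e₀.2.ne, monoInd, Finset.prod_singleton]

theorem clusteringRisk_ge {n k D : ℕ} (hn : 2 ≤ n) (hk : 1 ≤ k) (hD : 1 ≤ D)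
    {p q r : ℝ} (hq : 0 < q) (hqp : q < p) (hp : p < 1) (hr0 : 0 < r) (hr1 : r < 1)
    (h : (p - q) ^ 2 / (q * (1 - p))
        ≤ r / ((D : ℝ) * ((D : ℝ) + 1)) ^ 2 * min ((k : ℝ) ^ 2 / (n : ℝ)) 1)
    (P : PolyEstimator n) (hP : P.DegreeLE D) :
    1 / (k : ℝ) - (1 / (k : ℝ) ^ 2 + r / ((1 - r) ^ 2 * (n : ℝ))) ≤ clusteringRisk k p q P := by
  have hv : 0 < q * (1 - p) := mul_pos hq (by linarith)
  have hpair : ∀ e₀ : VertexPair n,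
      1 / (k : ℝ) - (1 / (k : ℝ) ^ 2 + r / ((1 - r) ^ 2 * (n : ℝ)))
        ≤ labelMean (k := k) (fun z => ∑ y, bernoulliWeight (edgeMean p q z) y *
          (P.evalAt (adjOfEdges y) e₀.1.1 e₀.1.2 - monoInd {e₀} z) ^ 2) := by
    intro e₀
    obtain ⟨a, ha⟩ :=
      exists_coeff_of_mem_lowDegree (eval_mem_lowDegree q (hP e₀.1.1 e₀.1.2))
    have hK := sum_sq_pairCumulant_mul_le hn hk hD hr0 hr1 (by positivity) h e₀
    have hR := pair_risk_ge hk hq hqp hp D a e₀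
    simp only [← ha] at hR
    exact (sub_le_sub_left hK _).trans hR
  have hc : (0 : ℝ) < (n.choose 2 : ℝ) := by exact_mod_cast Nat.choose_pos hn
  have hsum := Finset.card_nsmul_le_sum Finset.univ _ _ fun e₀ _ => hpair e₀
  rw [Finset.card_univ, card_vertexPair, nsmul_eq_mul] at hsum
  rwa [clusteringRisk_eq k hqp, one_div_mul_eq_div, le_div_iff₀' hc]

theorem theorem4 (n k D : ℕ) (hn : 2 ≤ n) (hk : 1 ≤ k) (hD : 1 ≤ D)
    (p q r : ℝ) (hq : 0 < q) (hqp : q < p) (hp : p < 1) (hr0 : 0 < r) (hr1 : r < 1) :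
    ((p - q) ^ 2 / (q * (1 - p))
        ≤ r / ((D : ℝ) * ((D : ℝ) + 1)) ^ 2 * min ((k : ℝ) ^ 2 / (n : ℝ)) 1 →
      ∀ Zhat : PolyEstimator n, Zhat.DegreeLE D →
        1 / (k : ℝ) - (1 / (k : ℝ) ^ 2 + r * (2 - r) / ((1 - r) ^ 2 * (n : ℝ)))
          ≤ clusteringRisk k p q Zhat) ∧
    ((k : ℝ) ≤ Real.sqrt (n : ℝ) →
      (n : ℝ) * (p - q) ^ 2 / ((k : ℝ) ^ 2 * q * (1 - p))
        ≤ r / ((D : ℝ) * ((D : ℝ) + 1)) ^ 2 →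
      ∀ Zhat : PolyEstimator n, Zhat.DegreeLE D →
        1 / (k : ℝ) - (1 / (k : ℝ) ^ 2 + r * (2 - r) / ((1 - r) ^ 2 * (n : ℝ)))
          ≤ clusteringRisk k p q Zhat) := by
  have hn' : (0 : ℝ) < n := by exact_mod_cast (by omega : 0 < n)
  have hk' : (0 : ℝ) < k := by exact_mod_cast hk
  have hr : 0 < 1 - r := by linarith
  have hv : 0 < q * (1 - p) := mul_pos hq (by linarith)
  have main : (p - q) ^ 2 / (q * (1 - p))
        ≤ r / ((D : ℝ) * ((D : ℝ) + 1)) ^ 2 * min ((k : ℝ) ^ 2 / (n : ℝ)) 1 →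
      ∀ Zhat : PolyEstimator n, Zhat.DegreeLE D →
        1 / (k : ℝ) - (1 / (k : ℝ) ^ 2 + r * (2 - r) / ((1 - r) ^ 2 * (n : ℝ)))
          ≤ clusteringRisk k p q Zhat := by
    intro h Zhat hZ
    refine le_trans ?_ (clusteringRisk_ge hn hk hD hq hqp hp hr0 hr1 h Zhat hZ)
    -- The argument yields the sharper constant `r` in place of `r(2-r)`.
    have : r ≤ r * (2 - r) := by nlinarith
    gcongr
  refine ⟨main, fun hkn h => main ?_⟩
  have hk2 : (k : ℝ) ^ 2 ≤ n := (Real.le_sqrt hk'.le hn'.le).1 hkn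
  rw [min_eq_left ((div_le_one hn').2 hk2)]
  calc (p - q) ^ 2 / (q * (1 - p))
      = (n : ℝ) * (p - q) ^ 2 / ((k : ℝ) ^ 2 * q * (1 - p)) * ((k : ℝ) ^ 2 / n) := by
        have : 1 - p ≠ 0 := by linarith
        field_simp
    _ ≤ _ := by gcongr
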